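/- Consider four point vortices of equal intensity $\Gamma_i=1$ in the plane, at positions $z_k=x_k+iy_k$, moving without collisions (for all times $t\in\mathbb R$) according to $$\dot x_k=\frac{\partial\mathcal H}{\partial y_k},\qquad \dot y_k=-\frac{\partial\mathcal H}{\partial x_k},\qquad \mathcal H=-\frac1{4\pi}\sum_{i<j}\ln|z_i-z_j|^2,$$ with centre of vorticity at the origin, $\sum_k x_k=\sum_k y_k=0$, and let $I=\sum_k(x_k^2+y_k^2)$. Suppose that at some time $t_0$ the vortices form a centrosymmetric configuration (a parallelogram, possibly degenerate) and that the constants of motion $\mathcal H$ and $I$ satisfy $$\frac{2\pi}{3}\mathcal H+\ln I<\frac16\ln 108 .$$ Then the motion is a simple relative choreography: there are an angular velocity $\Omega\in\mathbb R$, a closed curve given by a continuous function $u:\mathbb R\to\mathbb C$ of some period $\tau>0$, and time lags $s_1,\dots,s_4\in\mathbb R$ such that $$e^{-i\Omega t}z_k(t)=u(t+s_k)\qquad\text{for all }t\in\mathbb R,\ k=1,\dots,4,$$ that is, in the frame rotating about the origin with angular velocity $\Omega$ all four vortices trace the same closed curve. -/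

import Mathlib

open Complex

noncomputable section

namespace PointVortex

variable {n : ℕ}

/-- The Hamiltonian `-(1/4π) ∑_{i<j} Γᵢ Γⱼ ln |rᵢ - rⱼ|²` of `n` point vortices on the plane, the
position of the `i`-th vortex being written as the complex number `xᵢ + i yᵢ`. -/
def hamiltonian (Γ : Fin n → ℝ) (z : Fin n → ℂ) : ℝ :=
  -(1 / (4 * Real.pi)) *
    ∑ i, ∑ j ∈ Finset.Ioi i, Γ i * Γ j * Real.log (‖z i - z j‖ ^ 2)

/-- The partial derivative of `F` with respect to the `x`-coordinate of the `i`-th vortex. -/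
def partialX (F : (Fin n → ℂ) → ℝ) (i : Fin n) (z : Fin n → ℂ) : ℝ :=
  deriv (fun s : ℝ => F (Function.update z i (z i + (s : ℂ)))) 0

/-- The partial derivative of `F` with respect to the `y`-coordinate of the `i`-th vortex. -/
def partialY (F : (Fin n → ℂ) → ℝ) (i : Fin n) (z : Fin n → ℂ) : ℝ :=
  deriv (fun s : ℝ => F (Function.update z i (z i + (s : ℂ) * I))) 0

/-- `z` is a motion of point vortices with intensities `Γ`: a collision-free solution of
`Γᵢ ẋᵢ = ∂H/∂yᵢ`, `Γᵢ ẏᵢ = -∂H/∂xᵢ`. -/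
structure IsMotion (Γ : Fin n → ℝ) (z : ℝ → Fin n → ℂ) : Prop where
  noCollision : ∀ t, Function.Injective (z t)
  differentiable : ∀ i, Differentiable ℝ (fun t => z t i)
  eq_x : ∀ t i, Γ i * deriv (fun s => (z s i).re) t = partialY (hamiltonian Γ) i (z t)
  eq_y : ∀ t i, Γ i * deriv (fun s => (z s i).im) t = -partialX (hamiltonian Γ) i (z t)

/-- The first integral `Q = ∑ Γᵢ xᵢ`. -/
def integralQ (Γ : Fin n → ℝ) (z : Fin n → ℂ) : ℝ := ∑ i, Γ i * (z i).re

/-- The first integral `P = ∑ Γᵢ yᵢ`. -/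
def integralP (Γ : Fin n → ℝ) (z : Fin n → ℂ) : ℝ := ∑ i, Γ i * (z i).im

/-- The first integral `I = ∑ Γᵢ (xᵢ² + yᵢ²)`. -/
def integralI (Γ : Fin n → ℝ) (z : Fin n → ℂ) : ℝ := ∑ i, Γ i * ((z i).re ^ 2 + (z i).im ^ 2)

/-- The configuration is mapped to itself by the reflection in some point `c` of the plane.
For four distinct points this says that they are the vertices of a (possibly degenerate)
parallelogram, in some order. -/
def IsCentrosymmetric (z : Fin n → ℂ) : Prop :=
  ∃ (c : ℂ) (σ : Equiv.Perm (Fin n)), ∀ i, z (σ i) = 2 * c - z i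

/-- The motion `z` is a simple relative choreography: in the frame of reference that rotates about
the origin with some constant angular velocity `Ω`, all vortices run along one and the same closed
curve `u`, following each other with constant time lags. -/
def IsSimpleRelativeChoreography (z : ℝ → Fin n → ℂ) : Prop :=
  ∃ (Ω τ : ℝ) (u : ℝ → ℂ) (s : Fin n → ℝ),
    0 < τ ∧ Continuous u ∧ Function.Periodic u τ ∧
      ∀ k t, Complex.exp (-((Ω * t : ℝ) : ℂ) * I) * z t k = u (t + s k)

end PointVortex

end

/-!
A parallelogram `a, b, -a, -b` is determined up to rotation by `S = |a|² + |b|²` and by the point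
`(X, U, V)` of the sphere of radius `S` given by `X = |a|² - |b|²` and `U + iV = 2 a b̄`. A
parallelogram of unit vortices remains one, `S` is constant, and the Hamiltonian becomes a function
of the level `(S² - X²) (S² - U²)²`. The assumption on `H` and `I` says that the level exceeds
`4 S⁶ / 27`, its value on the separatrix. Above it `V` cannot vanish, and then `X + iU` turns around
`0` with an angular velocity bounded away from `0`. As the level decreases along rays from `0`, half
a turn takes `X + iU` exactly to `-(X + iU)` and restores `V`: up to a rotation `w` of the plane,
`(a, b)` has become `(b, -a)`. By uniqueness of solutions each vortex then takes, at every time, the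
place of the next one up to the rotation `w`, which is a choreography in a uniformly rotating frame.
-/

open scoped ComplexConjugate

theorem eq_of_hasDerivAt_of_contDiffAt {E : Type*} [NormedAddCommGroup E] [NormedSpace ℝ E]
    {v : E → E} {y z : ℝ → E} (hv : ∀ t, ContDiffAt ℝ 1 v (z t))
    (hy : ∀ t, HasDerivAt y (v (y t)) t) (hz : ∀ t, HasDerivAt z (v (z t)) t) {t₀ : ℝ}
    (h : y t₀ = z t₀) : y = z := by
  have hyc : Continuous y := continuous_iff_continuousAt.2 fun t => (hy t).continuousAt
  have hzc : Continuous z := continuous_iff_continuousAt.2 fun t => (hz t).continuousAt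
  have hopen : IsOpen {t | y t = z t} := by
    refine isOpen_iff_mem_nhds.2 fun t (ht : y t = z t) => ?_
    obtain ⟨K, s, hs, hK⟩ := (hv t).exists_lipschitzOnWith
    refine ODE_solution_unique_of_eventually (v := fun _ => v) (s := fun _ => s)
      (Filter.Eventually.of_forall fun _ => hK) ?_ ?_ ht
    · filter_upwards [hyc.continuousAt (ht ▸ hs)] with r hr using ⟨hy r, hr⟩
    · filter_upwards [hzc.continuousAt hs] with r hr using ⟨hz r, hr⟩
  have huniv := IsClopen.eq_univ ⟨isClosed_eq hyc hzc, hopen⟩ ⟨t₀, h⟩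
  exact funext fun t => (Set.eq_univ_iff_forall.1 huniv t :)

theorem hasDerivAt_complex_mk {f g : ℝ → ℝ} {f' g' t : ℝ} (hf : HasDerivAt f f' t)
    (hg : HasDerivAt g g' t) : HasDerivAt (fun s => (⟨f s, g s⟩ : ℂ)) ⟨f', g'⟩ t := by
  simpa only [mk_eq_add_mul_I] using hf.ofReal_comp.fun_add (hg.ofReal_comp.mul_const I)

theorem hasDerivAt_re_mul_conj {f g : ℝ → ℂ} {f' g' : ℂ} {t : ℝ} (hf : HasDerivAt f f' t)
    (hg : HasDerivAt g g' t) :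
    HasDerivAt (fun s => (f s * conj (g s)).re) (f' * conj (g t) + g' * conj (f t)).re t := by
  refine (reCLM.hasFDerivAt.comp_hasDerivAt t (hf.fun_mul hg.star)).congr_deriv ?_
  simp only [star_def, reCLM_apply, add_re, mul_re, conj_re, conj_im]
  ring

theorem hasDerivAt_normSq {f : ℝ → ℂ} {f' : ℂ} {t : ℝ} (hf : HasDerivAt f f' t) :
    HasDerivAt (fun s => normSq (f s)) (2 * (f' * conj (f t)).re) t := by
  simpa only [mul_conj, ofReal_re, add_re, two_mul] using hasDerivAt_re_mul_conj hf hf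

section AngularVelocity

variable {W W' : ℝ → ℂ}

theorem eq_mul_exp_integral_div (hW : ∀ t, HasDerivAt W (W' t) t) (hW' : Continuous W')
    (h0 : ∀ t, W t ≠ 0) (t₀ t : ℝ) : W t = W t₀ * exp (∫ s in t₀..t, W' s / W s) := by
  have hWc : Continuous W := continuous_iff_continuousAt.2 fun t => (hW t).continuousAt
  set ℓ : ℝ → ℂ := fun t => ∫ s in t₀..t, W' s / W s
  have hℓ : ∀ t, HasDerivAt ℓ (W' t / W t) t := fun t =>
    ((hW'.div hWc h0).integral_hasStrictDerivAt t₀ t).hasDerivAt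
  have hquot : ∀ t, HasDerivAt (fun t => W t * exp (-ℓ t)) 0 t := fun t => by
    refine ((hW t).fun_mul (hℓ t).fun_neg.cexp).congr_deriv ?_
    have := h0 t
    field_simp
    ring
  have hconst : W t * exp (-ℓ t) = W t₀ := by
    have := is_const_of_deriv_eq_zero (fun t => (hquot t).differentiableAt)
      (fun t => (hquot t).deriv) t t₀
    simpa [ℓ] using this
  rw [← hconst, mul_assoc, ← exp_add, neg_add_cancel, exp_zero, mul_one]

theorem exists_eq_mul_exp_of_le_im_div (hW : ∀ t, HasDerivAt W (W' t) t) (hW' : Continuous W')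
    (h0 : ∀ t, W t ≠ 0) {c θ : ℝ} (hc : 0 < c) (hθ : 0 < θ) (hang : ∀ t, c ≤ (W' t / W t).im)
    (t₀ : ℝ) : ∃ h > 0, ∃ r : ℝ, 0 < r ∧ W (t₀ + h) = r * exp (θ * I) * W t₀ := by
  have hWc : Continuous W := continuous_iff_continuousAt.2 fun t => (hW t).continuousAt
  have hquot : Continuous fun t => W' t / W t := hW'.div hWc h0
  set ℓ : ℝ → ℂ := fun h => ∫ s in t₀..t₀ + h, W' s / W s with hℓ
  have hℓc : Continuous ℓ :=
    (intervalIntegral.continuous_primitive (fun a b => hquot.intervalIntegrable a b) t₀).comp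
      (continuous_const_add t₀)
  have hgrow : θ ≤ (ℓ (θ / c)).im := calc
    θ = ∫ _ in t₀..t₀ + θ / c, c := by
      rw [intervalIntegral.integral_const, add_sub_cancel_left, smul_eq_mul,
        div_mul_cancel₀ _ hc.ne']
    _ ≤ ∫ s in t₀..t₀ + θ / c, (W' s / W s).im :=
      intervalIntegral.integral_mono (le_add_of_nonneg_right (by positivity))
        intervalIntegrable_const ((continuous_im.comp hquot).intervalIntegrable _ _) hang
    _ = (ℓ (θ / c)).im :=
      imCLM.intervalIntegral_comp_comm (hquot.intervalIntegrable _ _)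
  obtain ⟨h, hh, hhθ⟩ := intermediate_value_Ioc (f := fun h => (ℓ h).im) (div_pos hθ hc).le
    (continuous_im.comp hℓc).continuousOn ⟨by simpa [hℓ] using hθ, hgrow⟩
  refine ⟨h, hh.1, Real.exp (ℓ h).re, Real.exp_pos _, ?_⟩
  rw [eq_mul_exp_integral_div hW hW' h0 t₀ (t₀ + h), mul_comm, ← hhθ, ofReal_exp, ← exp_add,
    re_add_im]

end AngularVelocity

section CyclicShift

variable {n : ℕ} [NeZero n]

theorem eq_ofNat_of_cyclic_shift {α : Type*} {ζ : ℝ → Fin n → α} {h : ℝ}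
    (hζ : ∀ t k, ζ (t + h) k = ζ t (k + 1)) (m : ℕ) (t : ℝ) :
    ζ (t + m * h) 0 = ζ t (Fin.ofNat n m) := by
  induction m generalizing t with
  | zero => simp
  | succ m ih =>
    have hsucc : Fin.ofNat n (m + 1) = Fin.ofNat n m + 1 := by
      simp [Fin.ext_iff, Fin.val_add]
    rw [hsucc, ← hζ, ← ih, Nat.cast_succ, add_mul, one_mul, add_right_comm, add_assoc t]

end CyclicShift

namespace PointVortex

section ReducedMotion

/-- The velocity of `W = X + iU` when `(W, V)`, a point of the sphere of radius `S` in `ℂ × ℝ`,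
consists of the coordinates `hopf a b` of the parallelogram `a, b, -a, -b` of unit vortices. -/
noncomputable def reducedVelocity (S : ℝ) (W : ℂ) (V : ℝ) : ℂ :=
  ⟨-(2 / Real.pi) * (W.im * V / (S ^ 2 - W.im ^ 2)), 1 / Real.pi * (W.re * V / (S ^ 2 - W.re ^ 2))⟩

/-- The first integral `(S² - X²)(S² - U²)²` of the reduced motion of `W = X + iU`. It is a
decreasing function of the Hamiltonian, see `IsParallelogram.hamiltonian_eq`. -/
noncomputable def reducedLevel (S : ℝ) (W : ℂ) : ℝ :=
  (S ^ 2 - W.re ^ 2) * (S ^ 2 - W.im ^ 2) ^ 2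

/-- `(W, V)` is a motion on the sphere of radius `S` that is driven by `reducedVelocity` and avoids
the collisions, which lie at `X² = S²` and `U² = S²` for `W = X + iU`. No equation of
motion is stated for `V`, which the sphere determines up to its sign. -/
structure IsReducedMotion (S : ℝ) (W : ℝ → ℂ) (V : ℝ → ℝ) : Prop where
  sphere : ∀ t, normSq (W t) + V t ^ 2 = S ^ 2
  re_sq_lt : ∀ t, (W t).re ^ 2 < S ^ 2
  im_sq_lt : ∀ t, (W t).im ^ 2 < S ^ 2
  hasDerivAt : ∀ t, HasDerivAt W (reducedVelocity S (W t) (V t)) t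
  continuous_snd : Continuous V

variable {S : ℝ}

theorem reducedLevel_ofReal_mul_lt {W : ℂ} (hW : W ≠ 0) (hre : W.re ^ 2 < S ^ 2)
    (him : W.im ^ 2 < S ^ 2) {r : ℝ} (hr0 : 0 ≤ r) (hr1 : r < 1) :
    reducedLevel S W < reducedLevel S (r * W) := by
  have hr : r ^ 2 < 1 := pow_lt_one₀ hr0 hr1 two_ne_zero
  have hle : ∀ x : ℝ, S ^ 2 - x ^ 2 ≤ S ^ 2 - (r * x) ^ 2 := fun x => by
    nlinarith [sq_nonneg x]
  have hlt : ∀ x : ℝ, x ≠ 0 → S ^ 2 - x ^ 2 < S ^ 2 - (r * x) ^ 2 := fun x hx => by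
    nlinarith [sq_pos_of_ne_zero hx]
  have hre' := sub_pos.2 hre
  have him' := sub_pos.2 him
  simp only [reducedLevel, re_ofReal_mul, im_ofReal_mul]
  by_cases h : W.re = 0
  · have h' : W.im ≠ 0 := fun h' => hW (Complex.ext h h')
    exact mul_lt_mul' (hle _) (pow_lt_pow_left₀ (hlt _ h') him'.le two_ne_zero) (by positivity)
      (hre'.trans_le (hle _))
  · exact mul_lt_mul (hlt _ h) (pow_le_pow_left₀ him'.le (hle _) 2) (by positivity)
      (hre'.trans_le (hle _)).le

theorem eq_one_of_reducedLevel_ofReal_mul_eq {W : ℂ} {r : ℝ} (hW : W ≠ 0) (hr : 0 < r)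
    (hre : W.re ^ 2 < S ^ 2) (him : W.im ^ 2 < S ^ 2) (hre' : (r * W).re ^ 2 < S ^ 2)
    (him' : (r * W).im ^ 2 < S ^ 2) (h : reducedLevel S (r * W) = reducedLevel S W) : r = 1 := by
  rcases lt_trichotomy r 1 with hr1 | hr1 | hr1
  · exact absurd h (reducedLevel_ofReal_mul_lt hW hre him hr.le hr1).ne'
  · exact hr1
  · have hr' : (r : ℂ) ≠ 0 := ofReal_ne_zero.2 hr.ne'
    have := reducedLevel_ofReal_mul_lt (mul_ne_zero hr' hW) hre' him' (inv_pos.2 hr).le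
      (inv_lt_one_of_one_lt₀ hr1)
    rw [ofReal_inv, inv_mul_cancel_left₀ hr'] at this
    exact absurd h this.ne

-- `4 S⁶ / 27` is the maximum of `U² (S² - U²)²`, the level on `V = 0`, attained at `U² = S² / 3`.
theorem reducedLevel_le {W : ℂ} {V : ℝ} (hsph : normSq W + V ^ 2 = S ^ 2) :
    27 * reducedLevel S W ≤ 4 * S ^ 6 + 27 * S ^ 4 * V ^ 2 := by
  rw [normSq_apply] at hsph
  have hre : S ^ 2 - W.re ^ 2 = W.im ^ 2 + V ^ 2 := by linear_combination -hsph
  have him : W.im ^ 2 ≤ S ^ 2 := by nlinarith [sq_nonneg W.re, sq_nonneg V]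
  have hamgm : 27 * (W.im ^ 2 * (S ^ 2 - W.im ^ 2) ^ 2) ≤ 4 * S ^ 6 := by
    nlinarith [mul_nonneg (sq_nonneg (3 * W.im ^ 2 - S ^ 2))
      (by nlinarith [sq_nonneg S] : 0 ≤ 4 * S ^ 2 - 3 * W.im ^ 2)]
  have hV : V ^ 2 * (S ^ 2 - W.im ^ 2) ^ 2 ≤ V ^ 2 * (S ^ 2) ^ 2 := by
    have := sub_nonneg.2 him
    gcongr
    exact sub_le_self _ (sq_nonneg _)
  rw [reducedLevel, hre]
  linarith

theorem div_le_im_reducedVelocity_div {W : ℂ} {V : ℝ} (hW : W ≠ 0) (hre : W.re ^ 2 < S ^ 2)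
    (him : W.im ^ 2 < S ^ 2) (hV : 0 ≤ V) :
    V / (Real.pi * S ^ 2) ≤ (reducedVelocity S W V / W).im := by
  have hre' := sub_pos.2 hre
  have him' := sub_pos.2 him
  have hS : 0 < S ^ 2 := (sq_nonneg _).trans_lt hre
  have hkey : normSq W / S ^ 2 ≤
      W.re ^ 2 / (S ^ 2 - W.re ^ 2) + 2 * (W.im ^ 2 / (S ^ 2 - W.im ^ 2)) := by
    have hx := div_le_div_of_nonneg_left (sq_nonneg W.re) hre' (sub_le_self _ (sq_nonneg W.re))
    have hu := div_le_div_of_nonneg_left (sq_nonneg W.im) him' (sub_le_self _ (sq_nonneg W.im))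
    have hu0 : 0 ≤ W.im ^ 2 / S ^ 2 := by positivity
    rw [normSq_apply, ← sq, ← sq, add_div]
    linarith
  calc V / (Real.pi * S ^ 2) = V / Real.pi * (normSq W / S ^ 2) / normSq W := by
        have := (normSq_pos.2 hW).ne'
        field_simp
    _ ≤ V / Real.pi * (W.re ^ 2 / (S ^ 2 - W.re ^ 2) + 2 * (W.im ^ 2 / (S ^ 2 - W.im ^ 2)))
          / normSq W := by
        have := normSq_nonneg W
        have := Real.pi_pos
        gcongr
    _ = (reducedVelocity S W V / W).im := by
        rw [div_im, ← sub_div, reducedVelocity]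
        ring

namespace IsReducedMotion

variable {W : ℝ → ℂ} {V : ℝ → ℝ}

protected theorem continuous_fst (h : IsReducedMotion S W V) : Continuous W :=
  continuous_iff_continuousAt.2 fun t => (h.hasDerivAt t).continuousAt

theorem continuous_reducedVelocity (h : IsReducedMotion S W V) :
    Continuous fun t => reducedVelocity S (W t) (V t) := by
  have hre : Continuous fun t => (W t).re := continuous_re.comp h.continuous_fst
  have him : Continuous fun t => (W t).im := continuous_im.comp h.continuous_fst
  have hX' := (him.mul h.continuous_snd).div (continuous_const.sub (him.pow 2))
    fun t => (sub_pos.2 (h.im_sq_lt t)).ne'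
  have hU' := (hre.mul h.continuous_snd).div (continuous_const.sub (hre.pow 2))
    fun t => (sub_pos.2 (h.re_sq_lt t)).ne'
  simp only [reducedVelocity, mk_eq_add_mul_I]
  exact (continuous_ofReal.comp (hX'.const_mul _)).add
    ((continuous_ofReal.comp (hU'.const_mul _)).mul_const _)

theorem conj_neg (h : IsReducedMotion S W V) :
    IsReducedMotion S (fun t => conj (W t)) fun t => -V t where
  sphere t := by rw [normSq_conj, neg_sq, h.sphere]
  re_sq_lt t := by rw [conj_re]; exact h.re_sq_lt t
  im_sq_lt t := by rw [conj_im, neg_sq]; exact h.im_sq_lt t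
  hasDerivAt t := (h.hasDerivAt t).star.congr_deriv (by
    apply Complex.ext <;> simp [reducedVelocity, neg_div])
  continuous_snd := h.continuous_snd.neg

theorem reducedLevel_eq (h : IsReducedMotion S W V) (s t : ℝ) :
    reducedLevel S (W s) = reducedLevel S (W t) := by
  have hderiv : ∀ t, HasDerivAt (fun t => reducedLevel S (W t)) 0 t := fun t => by
    have hre := reCLM.hasFDerivAt.comp_hasDerivAt t (h.hasDerivAt t)
    have him := imCLM.hasFDerivAt.comp_hasDerivAt t (h.hasDerivAt t)
    refine (((hre.fun_pow 2).const_sub (S ^ 2)).fun_mul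
      (((him.fun_pow 2).const_sub (S ^ 2)).fun_pow 2)).congr_deriv ?_
    have := (sub_pos.2 (h.re_sq_lt t)).ne'
    have := (sub_pos.2 (h.im_sq_lt t)).ne'
    simp only [reducedVelocity, Function.comp_apply, reCLM_apply, imCLM_apply]
    field_simp
    ring
  exact is_const_of_deriv_eq_zero (fun t => (hderiv t).differentiableAt)
    (fun t => (hderiv t).deriv) s t

theorem ne_zero_of_ne_zero (h : IsReducedMotion S W V) {t₀ : ℝ} (h0 : W t₀ ≠ 0) (t : ℝ) :
    W t ≠ 0 := fun ht => by
  have hlt := reducedLevel_ofReal_mul_lt h0 (h.re_sq_lt t₀) (h.im_sq_lt t₀) le_rfl one_pos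
  rw [ofReal_zero, zero_mul, ← ht, h.reducedLevel_eq t t₀] at hlt
  exact hlt.false

theorem exists_pos_le_sq (h : IsReducedMotion S W V) {t₀ : ℝ}
    (hlevel : 4 * S ^ 6 < 27 * reducedLevel S (W t₀)) : ∃ d > 0, ∀ t, d ≤ V t ^ 2 := by
  have hS : S ≠ 0 := sq_pos_iff.1 ((sq_nonneg _).trans_lt (h.re_sq_lt t₀))
  have hS4 : 0 < 27 * S ^ 4 := by positivity
  refine ⟨(27 * reducedLevel S (W t₀) - 4 * S ^ 6) / (27 * S ^ 4),
    div_pos (sub_pos.2 hlevel) hS4, fun t => ?_⟩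
  rw [div_le_iff₀' hS4, h.reducedLevel_eq t₀ t]
  linarith [reducedLevel_le (h.sphere t)]

theorem pos_of_pos (h : IsReducedMotion S W V) {t₀ : ℝ}
    (hlevel : 4 * S ^ 6 < 27 * reducedLevel S (W t₀)) (hV : 0 < V t₀) (t : ℝ) : 0 < V t := by
  obtain ⟨d, hd, hdV⟩ := h.exists_pos_le_sq hlevel
  by_contra! hneg
  obtain ⟨s, -, hs⟩ := intermediate_value_uIcc h.continuous_snd.continuousOn
    (Set.mem_uIcc.2 (Or.inr ⟨hneg, hV.le⟩))
  have := hdV s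
  rw [hs] at this
  linarith

theorem exists_half_turn_of_pos (h : IsReducedMotion S W V) {t₀ : ℝ}
    (hlevel : 4 * S ^ 6 < 27 * reducedLevel S (W t₀)) (hV : 0 < V t₀) :
    ∃ τ > 0, W (t₀ + τ) = -W t₀ ∧ V (t₀ + τ) = V t₀ := by
  have hVpos := h.pos_of_pos hlevel hV
  suffices ∃ τ > 0, W (t₀ + τ) = -W t₀ by
    obtain ⟨τ, hτ, hW⟩ := this
    refine ⟨τ, hτ, hW, (sq_eq_sq₀ (hVpos _).le hV.le).1 ?_⟩
    have := (h.sphere (t₀ + τ)).trans (h.sphere t₀).symm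
    rwa [hW, normSq_neg, add_right_inj] at this
  by_cases h0 : W t₀ = 0
  · refine ⟨1, one_pos, ?_⟩
    rw [h0, neg_zero]
    by_contra h1
    exact h.ne_zero_of_ne_zero h1 t₀ h0
  have hS : 0 < S ^ 2 := (sq_nonneg _).trans_lt (h.re_sq_lt t₀)
  obtain ⟨d, hd, hdV⟩ := h.exists_pos_le_sq hlevel
  have hang : ∀ t, √d / (Real.pi * S ^ 2) ≤ (reducedVelocity S (W t) (V t) / W t).im := fun t =>
    (div_le_div_of_nonneg_right (Real.sqrt_le_iff.2 ⟨(hVpos t).le, hdV t⟩) (by positivity)).trans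
      (div_le_im_reducedVelocity_div (h.ne_zero_of_ne_zero h0 t) (h.re_sq_lt t) (h.im_sq_lt t)
        (hVpos t).le)
  obtain ⟨τ, hτ, r, hr, hrW⟩ := exists_eq_mul_exp_of_le_im_div h.hasDerivAt
    h.continuous_reducedVelocity (h.ne_zero_of_ne_zero h0) (by positivity) Real.pi_pos hang t₀
  have hneg : W (t₀ + τ) = r * -W t₀ := by rw [hrW, exp_pi_mul_I, mul_assoc, neg_one_mul]
  have hr1 : r = 1 := by
    have hre := h.re_sq_lt (t₀ + τ)
    have him := h.im_sq_lt (t₀ + τ)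
    have hE := h.reducedLevel_eq (t₀ + τ) t₀
    rw [hneg] at hre him hE
    refine eq_one_of_reducedLevel_ofReal_mul_eq (neg_ne_zero.2 h0) hr ?_ ?_ hre him ?_
    · rw [neg_re, neg_sq]; exact h.re_sq_lt t₀
    · rw [neg_im, neg_sq]; exact h.im_sq_lt t₀
    · rw [hE]; simp [reducedLevel]
  exact ⟨τ, hτ, by rw [hneg, hr1, ofReal_one, one_mul]⟩

theorem exists_half_turn (h : IsReducedMotion S W V) {t₀ : ℝ}
    (hlevel : 4 * S ^ 6 < 27 * reducedLevel S (W t₀)) :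
    ∃ τ > 0, W (t₀ + τ) = -W t₀ ∧ V (t₀ + τ) = V t₀ := by
  obtain ⟨d, hd, hdV⟩ := h.exists_pos_le_sq hlevel
  have hV : V t₀ ≠ 0 := fun hV => by simpa [hV] using hd.trans_le (hdV t₀)
  rcases hV.lt_or_gt with hneg | hpos
  · obtain ⟨τ, hτ, hW, hVτ⟩ := h.conj_neg.exists_half_turn_of_pos
      (by simpa [reducedLevel] using hlevel) (neg_pos.2 hneg)
    exact ⟨τ, hτ, star_injective (hW.trans (map_neg conj _).symm), neg_injective hVτ⟩
  · exact h.exists_half_turn_of_pos hlevel hpos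

end IsReducedMotion

end ReducedMotion

section Dynamics

variable {n : ℕ} {Γ : Fin n → ℝ}

/-- The velocity which the vortices `z` with intensities `Γ` induce at the `k`-th of them, as a
complex number. The term `j = k` of the sum is `Γ k / 0 = 0`. -/
noncomputable def velocity (Γ : Fin n → ℝ) (z : Fin n → ℂ) (k : Fin n) : ℂ :=
  I / (2 * Real.pi) * conj (∑ j, Γ j / (z k - z j))

theorem hamiltonian_eq_sum_sum (Γ : Fin n → ℝ) (z : Fin n → ℂ) :
    hamiltonian Γ z =
      -(1 / (8 * Real.pi)) * ∑ i, ∑ j, Γ i * Γ j * Real.log (‖z i - z j‖ ^ 2) := by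
  set f : Fin n → Fin n → ℝ := fun i j => Γ i * Γ j * Real.log (‖z i - z j‖ ^ 2) with hf
  have hsymm : ∀ i j, f i j = f j i := fun i j => by simp only [hf, norm_sub_rev, mul_comm (Γ i)]
  have hdiag : ∀ i, f i i = 0 := fun i => by simp [hf]
  have hpairs : 2 * ∑ i, ∑ j ∈ Finset.Ioi i, f i j = ∑ i, ∑ j, f i j := calc
    _ = ∑ i, ∑ j ∈ Finset.Ioi i, (f j i + f i j) := by
      simp only [Finset.mul_sum, two_mul, hsymm]
    _ = ∑ i, ∑ j ∈ {i}ᶜ, f j i := Finset.sum_sum_Ioi_add_eq_sum_sum_off_diag f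
    _ = ∑ i, ∑ j, f i j := Finset.sum_congr rfl fun i _ => by
      rw [← Finset.sum_compl_add_sum {i}, Finset.sum_singleton, hdiag, add_zero]
      exact Finset.sum_congr rfl fun j _ => hsymm j i
  rw [← hpairs, hamiltonian]
  ring

theorem hamiltonian_comp_perm (Γ : Fin n → ℝ) (z : Fin n → ℂ) (e : Equiv.Perm (Fin n)) :
    hamiltonian (fun k => Γ (e k)) (fun k => z (e k)) = hamiltonian Γ z := by
  rw [hamiltonian_eq_sum_sum, hamiltonian_eq_sum_sum,
    ← Equiv.sum_comp e fun i => ∑ j, Γ i * Γ j * Real.log (‖z i - z j‖ ^ 2)]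
  congr 2 with i
  exact Equiv.sum_comp e fun j => Γ (e i) * Γ j * Real.log (‖z (e i) - z j‖ ^ 2)

theorem integralI_comp_perm (Γ : Fin n → ℝ) (z : Fin n → ℂ) (e : Equiv.Perm (Fin n)) :
    integralI (fun k => Γ (e k)) (fun k => z (e k)) = integralI Γ z :=
  Equiv.sum_comp e fun i => Γ i * ((z i).re ^ 2 + (z i).im ^ 2)

theorem hasDerivAt_log_norm_sq_add_mul {c : ℂ} (hc : c ≠ 0) (d : ℂ) :
    HasDerivAt (fun s : ℝ => Real.log (‖c + s * d‖ ^ 2)) (2 * (d / c).re) 0 := by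
  have hline : HasDerivAt (fun s : ℝ => c + s * d) d 0 := by
    simpa using ((ofRealCLM.hasDerivAt (x := (0 : ℝ))).mul_const d).const_add c
  refine (hline.norm_sq.log (by simpa using hc)).congr_deriv ?_
  rw [ofReal_zero, zero_mul, add_zero, Complex.inner, div_re, ← normSq_eq_norm_sq]
  simp only [mul_re, conj_re, conj_im]
  ring

theorem hasDerivAt_hamiltonian {z : Fin n → ℂ} (hz : Function.Injective z) (δ : Fin n → ℂ) :
    HasDerivAt (fun s : ℝ => hamiltonian Γ fun k => z k + s * δ k)
      (-(1 / (2 * Real.pi)) * (∑ i, Γ i * δ i * ∑ j, Γ j / (z i - z j)).re) 0 := by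
  have hpair : ∀ i j, HasDerivAt
      (fun s : ℝ => Γ i * Γ j * Real.log (‖z i + s * δ i - (z j + s * δ j)‖ ^ 2))
      (2 * (Γ i * Γ j * ((δ i - δ j) / (z i - z j))).re) 0 := fun i j => by
    obtain rfl | hij := eq_or_ne i j
    · simpa using hasDerivAt_const (0 : ℝ) (0 : ℝ)
    · have hlog := (hasDerivAt_log_norm_sq_add_mul (sub_ne_zero.2 (hz.ne hij))
        (δ i - δ j)).const_mul (Γ i * Γ j)
      simp only [mul_sub, ← add_sub_add_comm] at hlog
      refine hlog.congr_deriv ?_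
      rw [← ofReal_mul, re_ofReal_mul]
      ring
  have hsum : ∑ i, ∑ j, Γ i * Γ j * ((δ i - δ j) / (z i - z j)) =
      2 * ∑ i, Γ i * δ i * ∑ j, Γ j / (z i - z j) := by
    have hswap : ∑ i, ∑ j, Γ i * Γ j * (-δ j / (z i - z j)) =
        ∑ i, ∑ j, (Γ i * Γ j * (δ i / (z i - z j)) : ℂ) := by
      rw [Finset.sum_comm]
      refine Finset.sum_congr rfl fun i _ => Finset.sum_congr rfl fun j _ => ?_
      rw [← neg_sub (z i), neg_div_neg_eq, mul_comm (Γ j : ℂ)]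
    simp only [sub_eq_add_neg (δ _), add_div, mul_add, Finset.sum_add_distrib, hswap, ← two_mul,
      Finset.mul_sum]
    refine Finset.sum_congr rfl fun i _ => Finset.sum_congr rfl fun j _ => ?_
    ring
  simp only [hamiltonian_eq_sum_sum]
  refine ((HasDerivAt.fun_sum fun i (_ : i ∈ Finset.univ) =>
    HasDerivAt.fun_sum fun j (_ : j ∈ Finset.univ) => hpair i j).const_mul
      (-(1 / (8 * Real.pi)))).congr_deriv ?_
  have hre := congrArg re hsum
  rw [← ofReal_ofNat, re_ofReal_mul] at hre
  simp only [re_sum] at hre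
  simp only [← Finset.mul_sum, hre, re_sum]
  ring

theorem hasDerivAt_hamiltonian_update {z : Fin n → ℂ} (hz : Function.Injective z) (k : Fin n)
    (d : ℂ) : HasDerivAt (fun s : ℝ => hamiltonian Γ (Function.update z k (z k + s * d)))
      (Γ k * (d * conj (I * velocity Γ z k)).re) 0 := by
  convert hasDerivAt_hamiltonian hz (Pi.single k d) using 1
  · ext s
    congr 1
    ext j
    obtain rfl | hj := eq_or_ne j k <;> simp [*]
  · have hvel : conj (I * velocity Γ z k) =
        (-(1 / (2 * Real.pi)) : ℝ) * ∑ j, Γ j / (z k - z j) := by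
      rw [velocity, ← mul_assoc, map_mul, conj_conj]
      congr 1
      simp only [map_mul, map_div₀, conj_I, conj_ofReal, map_ofNat]
      push_cast
      linear_combination (1 / (2 * (Real.pi : ℂ))) * I_sq
    rw [Finset.sum_eq_single k (by simp +contextual) (by simp), Pi.single_eq_same, hvel,
      mul_left_comm, re_ofReal_mul, mul_assoc (Γ k : ℂ), re_ofReal_mul]
    ring

theorem partialX_hamiltonian {z : Fin n → ℂ} (hz : Function.Injective z) (k : Fin n) :
    partialX (hamiltonian Γ) k z = -(Γ k * (velocity Γ z k).im) := by
  simpa [partialX] using (hasDerivAt_hamiltonian_update hz k 1).deriv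

theorem partialY_hamiltonian {z : Fin n → ℂ} (hz : Function.Injective z) (k : Fin n) :
    partialY (hamiltonian Γ) k z = Γ k * (velocity Γ z k).re := by
  simpa [partialY] using (hasDerivAt_hamiltonian_update hz k I).deriv

theorem isMotion_iff (hΓ : ∀ k, Γ k ≠ 0) {z : ℝ → Fin n → ℂ} :
    IsMotion Γ z ↔ (∀ t, Function.Injective (z t)) ∧
      ∀ t k, HasDerivAt (fun s => z s k) (velocity Γ (z t) k) t := by
  constructor
  · intro hz
    refine ⟨hz.noCollision, fun t k => ?_⟩
    have hd := (hz.differentiable k t).hasDerivAt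
    have hre : HasDerivAt (fun s => (z s k).re) _ t := reCLM.hasFDerivAt.comp_hasDerivAt t hd
    have him : HasDerivAt (fun s => (z s k).im) _ t := imCLM.hasFDerivAt.comp_hasDerivAt t hd
    have hx := hz.eq_x t k
    have hy := hz.eq_y t k
    rw [hre.deriv, partialY_hamiltonian (hz.noCollision t), mul_right_inj' (hΓ k)] at hx
    rw [him.deriv, partialX_hamiltonian (hz.noCollision t), neg_neg, mul_right_inj' (hΓ k)] at hy
    exact hd.congr_deriv (Complex.ext hx hy)
  · rintro ⟨hinj, hd⟩
    refine ⟨hinj, fun k t => (hd t k).differentiableAt, fun t k => ?_, fun t k => ?_⟩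
    · rw [partialY_hamiltonian (hinj t)]
      exact congrArg _ (reCLM.hasFDerivAt.comp_hasDerivAt t (hd t k)).deriv
    · rw [partialX_hamiltonian (hinj t), neg_neg]
      exact congrArg _ (imCLM.hasFDerivAt.comp_hasDerivAt t (hd t k)).deriv

theorem contDiffAt_velocity {z : Fin n → ℂ} (hz : Function.Injective z) :
    ContDiffAt ℝ 1 (velocity Γ) z := by
  refine contDiffAt_pi.2 fun k => contDiffAt_const.mul
    (conjCLE.contDiff.contDiffAt.comp z (ContDiffAt.sum fun j _ => ?_))
  obtain rfl | hj := eq_or_ne k j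
  · simpa using contDiffAt_const
  · exact contDiffAt_const.mul (ContDiffAt.inv (by fun_prop) (sub_ne_zero.2 (hz.ne hj)))

theorem velocity_rotate_comp_perm (z : Fin n → ℂ) {w : ℂ} (hw : ‖w‖ = 1)
    (e : Equiv.Perm (Fin n)) (k : Fin n) :
    velocity (fun k => Γ (e k)) (fun k => w * z (e k)) k = w * velocity Γ z (e k) := by
  have hsum : ∑ j, (Γ (e j) : ℂ) / (w * z (e k) - w * z (e j)) =
      w⁻¹ * ∑ j, Γ j / (z (e k) - z j) := by
    rw [← Equiv.sum_comp e fun j => (Γ j : ℂ) / (z (e k) - z j), Finset.mul_sum]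
    refine Finset.sum_congr rfl fun j _ => ?_
    rw [← mul_sub, div_mul_eq_div_div_swap, div_eq_inv_mul]
  rw [velocity, velocity, hsum, map_mul, inv_eq_conj hw, conj_conj]
  ring

namespace IsMotion

variable {z : ℝ → Fin n → ℂ}

theorem hasDerivAt (hz : IsMotion Γ z) (hΓ : ∀ k, Γ k ≠ 0) (t : ℝ) (k : Fin n) :
    HasDerivAt (fun s => z s k) (velocity Γ (z t) k) t :=
  ((isMotion_iff hΓ).1 hz).2 t k

theorem eq_of_eq_at {y : ℝ → Fin n → ℂ} (hy : IsMotion Γ y) (hz : IsMotion Γ z)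
    (hΓ : ∀ k, Γ k ≠ 0) {t₀ : ℝ} (h : y t₀ = z t₀) : y = z :=
  eq_of_hasDerivAt_of_contDiffAt (fun t => contDiffAt_velocity (hz.noCollision t))
    (fun t => hasDerivAt_pi.2 (hy.hasDerivAt hΓ t)) (fun t => hasDerivAt_pi.2 (hz.hasDerivAt hΓ t))
    h

theorem comp_add_const (hz : IsMotion Γ z) (h : ℝ) : IsMotion Γ fun t => z (t + h) where
  noCollision _ := hz.noCollision _
  differentiable k := (hz.differentiable k).comp (differentiable_id.add_const h)
  eq_x t k := by
    rw [deriv_comp_add_const (fun s => (z s k).re), hz.eq_x]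
  eq_y t k := by
    rw [deriv_comp_add_const (fun s => (z s k).im), hz.eq_y]

theorem rotate_comp_perm (hz : IsMotion Γ z) (hΓ : ∀ k, Γ k ≠ 0) {w : ℂ} (hw : ‖w‖ = 1)
    (e : Equiv.Perm (Fin n)) : IsMotion (fun k => Γ (e k)) fun t k => w * z t (e k) := by
  have hw0 : w ≠ 0 := norm_ne_zero_iff.1 (hw ▸ one_ne_zero)
  refine (isMotion_iff fun k => hΓ (e k)).2
    ⟨fun t => (mul_right_injective₀ hw0).comp ((hz.noCollision t).comp e.injective), fun t k => ?_⟩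
  rw [velocity_rotate_comp_perm _ hw]
  exact (hz.hasDerivAt hΓ t (e k)).const_mul w

theorem eq_rotate_comp_perm (hz : IsMotion Γ z) (hΓ : ∀ k, Γ k ≠ 0) {w : ℂ} (hw : ‖w‖ = 1)
    {e : Equiv.Perm (Fin n)} (he : ∀ k, Γ (e k) = Γ k) {h t₀ : ℝ}
    (h₀ : ∀ k, z (t₀ + h) k = w * z t₀ (e k)) (t : ℝ) (k : Fin n) :
    z (t + h) k = w * z t (e k) := by
  have hrot := hz.rotate_comp_perm hΓ hw e
  simp only [he] at hrot
  exact congrFun (congrFun ((hz.comp_add_const h).eq_of_eq_at hrot hΓ (funext h₀)) t) k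

end IsMotion

end Dynamics

section Choreography

variable {n : ℕ}

theorem IsSimpleRelativeChoreography.comp {m : ℕ} {z : ℝ → Fin n → ℂ}
    (hz : IsSimpleRelativeChoreography z) (f : Fin m → Fin n) :
    IsSimpleRelativeChoreography fun t k => z t (f k) := by
  obtain ⟨Ω, τ, u, s, hτ, huc, hup, hzu⟩ := hz
  exact ⟨Ω, τ, u, fun k => s (f k), hτ, huc, hup, fun k => hzu (f k)⟩

theorem isSimpleRelativeChoreography_of_cyclic_shift [NeZero n] {z : ℝ → Fin n → ℂ}
    (hz : Continuous fun t => z t 0) {h : ℝ} (hh : 0 < h) {w : ℂ} (hw : ‖w‖ = 1)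
    (hs : ∀ t k, z (t + h) k = w * z t (k + 1)) : IsSimpleRelativeChoreography z := by
  set Ω : ℝ := w.arg / h
  have hΩ : exp (-((Ω * h : ℝ) : ℂ) * I) * w = 1 := by
    have harg : Ω * h = w.arg := div_mul_cancel₀ _ hh.ne'
    have hpolar : exp (w.arg * I) = w := by simpa [hw] using norm_mul_exp_arg_mul_I w
    have hw0 : w ≠ 0 := norm_ne_zero_iff.1 (hw ▸ one_ne_zero)
    rw [harg, neg_mul, exp_neg, hpolar, inv_mul_cancel₀ hw0]
  set ζ : ℝ → Fin n → ℂ := fun t k => exp (-((Ω * t : ℝ) : ℂ) * I) * z t k with hζ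
  have hshift : ∀ t k, ζ (t + h) k = ζ t (k + 1) := fun t k => by
    have hexp : exp (-((Ω * (t + h) : ℝ) : ℂ) * I) =
        exp (-((Ω * t : ℝ) : ℂ) * I) * exp (-((Ω * h : ℝ) : ℂ) * I) := by
      rw [← exp_add]
      push_cast
      ring_nf
    simp only [hζ, hs, hexp]
    linear_combination exp (-((Ω * t : ℝ) : ℂ) * I) * z t (k + 1) * hΩ
  have hn : 0 < n := NeZero.pos n
  refine ⟨Ω, n * h, fun t => ζ t 0, fun k => (k : ℕ) * h, by positivity, by fun_prop,
    fun t => ?_, fun k t => ?_⟩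
  · simpa using eq_ofNat_of_cyclic_shift hshift n t
  · simp only [eq_ofNat_of_cyclic_shift hshift, Fin.ofNat_val_eq_self]
    rfl

end Choreography

section Hopf

/-- The Hopf map `ℂ² → ℂ × ℝ`. Its fibres are the orbits of the simultaneous rotations of `a` and
`b`, so it serves as coordinates for the parallelograms `a, b, -a, -b` up to rotation. -/
noncomputable def hopf (a b : ℂ) : ℂ × ℝ :=
  (⟨normSq a - normSq b, 2 * (a * conj b).re⟩, 2 * (a * conj b).im)

theorem normSq_hopf_fst_add_sq (a b : ℂ) :
    normSq (hopf a b).1 + (hopf a b).2 ^ 2 = (normSq a + normSq b) ^ 2 := by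
  simp only [hopf, normSq_apply, mul_re, mul_im, conj_re, conj_im]
  ring

theorem sq_sub_hopf_re_sq (a b : ℂ) :
    (normSq a + normSq b) ^ 2 - (hopf a b).1.re ^ 2 = 4 * (normSq a * normSq b) := by
  simp only [hopf]
  ring

theorem sq_sub_hopf_im_sq (a b : ℂ) :
    (normSq a + normSq b) ^ 2 - (hopf a b).1.im ^ 2 = normSq (a ^ 2 - b ^ 2) := by
  simp only [hopf, normSq_apply, pow_two, sub_re, sub_im, mul_re, mul_im, conj_re, conj_im]
  ring

theorem hopf_neg_right (a b : ℂ) : hopf b (-a) = (-(hopf a b).1, (hopf a b).2) := by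
  refine Prod.ext (Complex.ext ?_ ?_) ?_ <;>
    simp only [hopf, normSq_neg, map_neg, mul_neg, neg_re, neg_im, mul_re, mul_im, conj_re,
      conj_im] <;> ring

theorem exists_norm_eq_one_of_hopf_eq {a b c d : ℂ} (hc : c ≠ 0) (h : hopf a b = hopf c d)
    (hS : normSq a + normSq b = normSq c + normSq d) :
    ∃ w : ℂ, ‖w‖ = 1 ∧ a = w * c ∧ b = w * d := by
  simp only [hopf, Prod.mk.injEq, Complex.mk.injEq, mul_eq_mul_left_iff, OfNat.ofNat_ne_zero,
    or_false] at h
  have hac : ‖a‖ = ‖c‖ := by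
    rw [Complex.norm_def, Complex.norm_def, show normSq a = normSq c by linarith [h.1.1]]
  have hcross : a * conj b = c * conj d := Complex.ext h.1.2 h.2
  have hw : ‖a / c‖ = 1 := by rw [norm_div, hac, div_self (norm_ne_zero_iff.2 hc)]
  have hw0 : a / c ≠ 0 := norm_ne_zero_iff.1 (hw ▸ one_ne_zero)
  have ha : a = a / c * c := (div_mul_cancel₀ a hc).symm
  refine ⟨a / c, hw, ha, ?_⟩
  have hbd : a / c * conj b = conj d := by
    rw [div_mul_eq_mul_div, hcross, mul_div_cancel_left₀ _ hc]
  rw [← conj_conj d, ← hbd, map_mul, conj_conj, ← inv_eq_conj hw, mul_inv_cancel_left₀ hw0]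

end Hopf

theorem re_I_div_mul_conj (x : ℂ) :
    (I / (2 * Real.pi) * conj x).re = 1 / (2 * Real.pi) * x.im := by
  have hI : I / (2 * Real.pi) = ((1 / (2 * Real.pi) : ℝ) : ℂ) * I := by
    push_cast
    ring
  rw [hI, mul_assoc, re_ofReal_mul, I_mul_re, conj_im, neg_neg]

/-- The four points `y` are the vertices `a, b, -a, -b`, in this order, of a (possibly degenerate)
parallelogram centred at the origin. -/
structure IsParallelogram (y : Fin 4 → ℂ) : Prop where
  injective : Function.Injective y
  neg : ∀ k, y (k + 2) = -y k

namespace IsParallelogram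

variable {y : Fin 4 → ℂ}

theorem two (hy : IsParallelogram y) : y 2 = -y 0 := hy.neg 0

theorem three (hy : IsParallelogram y) : y 3 = -y 1 := hy.neg 1

theorem comp_add_one (hy : IsParallelogram y) : IsParallelogram fun k => y (k + 1) :=
  ⟨hy.injective.comp (add_left_injective 1), fun k => by rw [add_right_comm, hy.neg]⟩

theorem ne_zero (hy : IsParallelogram y) (k : Fin 4) : y k ≠ 0 := fun h => by
  have h2 : k + 2 = k := hy.injective (by rw [hy.neg, h, neg_zero])
  exact absurd (add_eq_left.1 h2) (by decide)

protected theorem sub_ne_zero (hy : IsParallelogram y) : y 0 - y 1 ≠ 0 :=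
  sub_ne_zero.2 (hy.injective.ne (by decide))

protected theorem add_ne_zero (hy : IsParallelogram y) : y 0 + y 1 ≠ 0 := by
  rw [← neg_neg (y 1), ← hy.three, ← sub_eq_add_neg]
  exact sub_ne_zero.2 (hy.injective.ne (by decide))

theorem sq_sub_sq_ne_zero (hy : IsParallelogram y) : y 0 ^ 2 - y 1 ^ 2 ≠ 0 := by
  rw [sq_sub_sq]
  exact mul_ne_zero hy.add_ne_zero hy.sub_ne_zero

theorem velocity_zero (hy : IsParallelogram y) : velocity (fun _ => 1) y 0 =
    I / (2 * Real.pi) * conj ((2 * y 0)⁻¹ + 2 * y 0 / (y 0 ^ 2 - y 1 ^ 2)) := by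
  have hsides : 2 * y 0 / (y 0 ^ 2 - y 1 ^ 2) = (y 0 - y 1)⁻¹ + (y 0 + y 1)⁻¹ := by
    have := hy.sub_ne_zero
    have := hy.add_ne_zero
    rw [sq_sub_sq]
    field_simp
    ring
  simp only [velocity, hsides, Fin.sum_univ_four, hy.two, hy.three, sub_self,
    sub_neg_eq_add, ← two_mul, ofReal_one, one_div]
  ring_nf

theorem velocity_one (hy : IsParallelogram y) : velocity (fun _ => 1) y 1 =
    I / (2 * Real.pi) * conj ((2 * y 1)⁻¹ - 2 * y 1 / (y 0 ^ 2 - y 1 ^ 2)) := by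
  have hrot := velocity_rotate_comp_perm (Γ := fun _ => 1) y norm_one (Equiv.addRight 1) 0
  simp only [one_mul, Equiv.coe_addRight, hy.comp_add_one.velocity_zero, zero_add,
    show (1 + 1 : Fin 4) = 2 from rfl, hy.two, neg_sq] at hrot
  rw [← hrot, ← neg_sub (y 0 ^ 2), div_neg, ← sub_eq_add_neg]

theorem re_velocity_zero_mul_conj (hy : IsParallelogram y) :
    (velocity (fun _ => 1) y 0 * conj (y 0)).re = -(1 / (2 * Real.pi)) *
      ((hopf (y 0) (y 1)).1.im * (hopf (y 0) (y 1)).2 / normSq (y 0 ^ 2 - y 1 ^ 2)) := by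
  have hmul : ((2 * y 0)⁻¹ + 2 * y 0 / (y 0 ^ 2 - y 1 ^ 2)) * y 0 =
      ((1 / 2 : ℝ) : ℂ) + ((2 : ℝ) : ℂ) * (y 0 ^ 2 / (y 0 ^ 2 - y 1 ^ 2)) := by
    have := hy.ne_zero 0
    push_cast
    field_simp
  have him : (y 0 ^ 2 / (y 0 ^ 2 - y 1 ^ 2)).im = -(1 / 2) *
      ((hopf (y 0) (y 1)).1.im * (hopf (y 0) (y 1)).2 / normSq (y 0 ^ 2 - y 1 ^ 2)) := by
    rw [div_im, ← sub_div, ← mul_div_assoc]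
    congr 1
    simp only [hopf, pow_two, sub_re, sub_im, mul_re, mul_im, conj_re, conj_im]
    ring
  rw [hy.velocity_zero, mul_assoc, ← map_mul, re_I_div_mul_conj, hmul, add_im, ofReal_im,
    im_ofReal_mul, him]
  ring

theorem re_velocity_one_mul_conj (hy : IsParallelogram y) :
    (velocity (fun _ => 1) y 1 * conj (y 1)).re = 1 / (2 * Real.pi) *
      ((hopf (y 0) (y 1)).1.im * (hopf (y 0) (y 1)).2 / normSq (y 0 ^ 2 - y 1 ^ 2)) := by
  have hrot := velocity_rotate_comp_perm (Γ := fun _ => 1) y norm_one (Equiv.addRight 1) 0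
  have hre := hy.comp_add_one.re_velocity_zero_mul_conj
  simp only [one_mul, Equiv.coe_addRight, zero_add] at hrot
  simp only [hrot, zero_add, show (1 + 1 : Fin 4) = 2 from rfl, hy.two, hopf_neg_right, neg_im,
    neg_sq] at hre
  rw [hre, ← neg_sub (y 0 ^ 2), normSq_neg]
  ring

theorem re_velocity_mul_conj_add (hy : IsParallelogram y) :
    (velocity (fun _ => 1) y 0 * conj (y 1) + velocity (fun _ => 1) y 1 * conj (y 0)).re =
      1 / (2 * Real.pi) * ((hopf (y 0) (y 1)).1.re * (hopf (y 0) (y 1)).2 /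
        (4 * (normSq (y 0) * normSq (y 1)))) := by
  have h0 := hy.ne_zero 0
  have h1 := hy.ne_zero 1
  have hmul : ((2 * y 0)⁻¹ + 2 * y 0 / (y 0 ^ 2 - y 1 ^ 2)) * y 1 +
      ((2 * y 1)⁻¹ - 2 * y 1 / (y 0 ^ 2 - y 1 ^ 2)) * y 0 =
        ((1 / 2 : ℝ) : ℂ) * (y 1 / y 0 + y 0 / y 1) := by
    push_cast
    field_simp
    ring
  have him : (y 1 / y 0 + y 0 / y 1).im = 2 * ((hopf (y 0) (y 1)).1.re * (hopf (y 0) (y 1)).2 /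
      (4 * (normSq (y 0) * normSq (y 1)))) := by
    have := (normSq_pos.2 h0).ne'
    have := (normSq_pos.2 h1).ne'
    simp only [hopf, add_im, div_im, mul_im, conj_re, conj_im]
    field_simp
    ring
  rw [hy.velocity_zero, hy.velocity_one, mul_assoc, mul_assoc, ← map_mul, ← map_mul, ← mul_add,
    ← map_add, re_I_div_mul_conj, hmul, im_ofReal_mul, him]
  ring

theorem integralI_eq (hy : IsParallelogram y) :
    integralI (fun _ => 1) y = 2 * (normSq (y 0) + normSq (y 1)) := by
  simp only [integralI, Fin.sum_univ_four, hy.two, hy.three, normSq_apply, neg_re, neg_im]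
  ring

theorem reducedLevel_hopf_pos (hy : IsParallelogram y) :
    0 < reducedLevel (normSq (y 0) + normSq (y 1)) (hopf (y 0) (y 1)).1 := by
  have := normSq_pos.2 (hy.ne_zero 0)
  have := normSq_pos.2 (hy.ne_zero 1)
  have := normSq_pos.2 hy.sq_sub_sq_ne_zero
  rw [reducedLevel, sq_sub_hopf_re_sq, sq_sub_hopf_im_sq]
  positivity

theorem hamiltonian_eq (hy : IsParallelogram y) :
    hamiltonian (fun _ => 1) y = -(1 / (4 * Real.pi)) *
      Real.log (4 * reducedLevel (normSq (y 0) + normSq (y 1)) (hopf (y 0) (y 1)).1) := by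
  have hlevel : 4 * reducedLevel (normSq (y 0) + normSq (y 1)) (hopf (y 0) (y 1)).1 =
      (2 * ‖y 0‖) ^ 2 * (2 * ‖y 1‖) ^ 2 * (‖y 0 - y 1‖ * ‖y 0 + y 1‖) ^ 4 := by
    rw [reducedLevel, sq_sub_hopf_re_sq, sq_sub_hopf_im_sq, sq_sub_sq, map_mul]
    simp only [normSq_eq_norm_sq]
    ring
  have h0 := norm_ne_zero_iff.2 (hy.ne_zero 0)
  have h1 := norm_ne_zero_iff.2 (hy.ne_zero 1)
  have hsub := norm_ne_zero_iff.2 hy.sub_ne_zero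
  have hadd := norm_ne_zero_iff.2 hy.add_ne_zero
  have hsub' : ‖-y 0 + y 1‖ = ‖y 0 - y 1‖ := by rw [neg_add_eq_sub, norm_sub_rev]
  have hadd' : ‖y 1 + y 0‖ = ‖y 0 + y 1‖ := by rw [add_comm]
  have hIoi : (Finset.Ioi (0 : Fin 4) = {1, 2, 3} ∧ Finset.Ioi (1 : Fin 4) = {2, 3}) ∧
      Finset.Ioi (2 : Fin 4) = {3} ∧ Finset.Ioi (3 : Fin 4) = ∅ := by decide
  rw [hlevel, Real.log_mul (by positivity) (by positivity),
    Real.log_mul (by positivity) (by positivity)]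
  simp only [hamiltonian, Fin.sum_univ_four, hIoi, hy.two, hy.three, Finset.sum_insert,
    Finset.mem_insert, Finset.mem_singleton, Fin.reduceEq, or_self, not_false_eq_true,
    Finset.sum_singleton, Finset.sum_empty, sub_neg_eq_add, hsub', hadd', ← two_mul, norm_mul,
    RCLike.norm_ofNat, Real.log_pow, Real.log_mul hsub hadd, one_mul]
  push_cast
  ring

theorem lt_reducedLevel_of_hamiltonian_lt (hy : IsParallelogram y)
    (h : 2 * Real.pi / 3 * hamiltonian (fun _ => 1) y + Real.log (integralI (fun _ => 1) y) <
      Real.log 108 / 6) :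
    4 * (normSq (y 0) + normSq (y 1)) ^ 6 <
      27 * reducedLevel (normSq (y 0) + normSq (y 1)) (hopf (y 0) (y 1)).1 := by
  have hS : 0 < normSq (y 0) + normSq (y 1) :=
    add_pos (normSq_pos.2 (hy.ne_zero 0)) (normSq_pos.2 (hy.ne_zero 1))
  have hL := hy.reducedLevel_hopf_pos
  rw [hy.hamiltonian_eq, hy.integralI_eq] at h
  set S := normSq (y 0) + normSq (y 1)
  set L := reducedLevel S (hopf (y 0) (y 1)).1
  have hcoeff : 2 * Real.pi / 3 * (-(1 / (4 * Real.pi)) * Real.log (4 * L)) =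
      -(Real.log (4 * L) / 6) := by
    have := Real.pi_pos.ne'
    field_simp
    ring
  have hlog : Real.log ((2 * S) ^ 6) < Real.log (108 * (4 * L)) := by
    rw [Real.log_pow, Real.log_mul (x := 108) (by simp) (by positivity)]
    push_cast
    linarith
  have hlt := (Real.log_lt_log_iff (by positivity) (by positivity)).1 hlog
  linarith [mul_pow 2 S 6]

end IsParallelogram

theorem exists_perm_of_involutive : ∀ σ : Equiv.Perm (Fin 4), (∀ i, σ (σ i) = i) →
    (∀ i j, σ i = i → σ j = j → i = j) →
      ∃ e : Equiv.Perm (Fin 4), ∀ k, σ (e k) = e (k + 2) := by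
  decide

theorem IsCentrosymmetric.exists_isParallelogram {z : Fin 4 → ℂ} (hz : Function.Injective z)
    (hsymm : IsCentrosymmetric z) (hsum : ∑ i, z i = 0) :
    ∃ e : Equiv.Perm (Fin 4), IsParallelogram fun k => z (e k) := by
  obtain ⟨c, σ, hσ⟩ := hsymm
  have hc : c = 0 := by
    have hsumσ := Equiv.sum_comp σ z
    simp only [hσ, Finset.sum_sub_distrib, hsum, sub_zero] at hsumσ
    simpa using hsumσ
  simp only [hc, mul_zero, zero_sub] at hσ
  have hfix : ∀ i, σ i = i → z i = 0 := fun i hi => self_eq_neg.1 (by rw [← hσ, hi])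
  obtain ⟨e, he⟩ := exists_perm_of_involutive σ (fun i => hz (by rw [hσ, hσ, neg_neg]))
    (fun i j hi hj => hz (by rw [hfix i hi, hfix j hj]))
  exact ⟨e, hz.comp e.injective, fun k => by rw [← he, hσ]⟩

namespace IsMotion

variable {y : ℝ → Fin 4 → ℂ}

protected theorem hasDerivAt_normSq (hy : IsMotion (fun _ => 1) y) (t : ℝ) (k : Fin 4) :
    HasDerivAt (fun s => normSq (y s k))
      (2 * (velocity (fun _ => 1) (y t) k * conj (y t k)).re) t :=
  hasDerivAt_normSq (hy.hasDerivAt (fun _ => one_ne_zero) t k)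

theorem normSq_add_normSq_eq (hy : IsMotion (fun _ => 1) y) (hp : ∀ t, IsParallelogram (y t))
    (s t : ℝ) : normSq (y s 0) + normSq (y s 1) = normSq (y t 0) + normSq (y t 1) := by
  have hd : ∀ t, HasDerivAt (fun t => normSq (y t 0) + normSq (y t 1)) 0 t := fun t => by
    refine ((hy.hasDerivAt_normSq t 0).fun_add (hy.hasDerivAt_normSq t 1)).congr_deriv ?_
    rw [(hp t).re_velocity_zero_mul_conj, (hp t).re_velocity_one_mul_conj]
    ring
  exact is_const_of_deriv_eq_zero (fun t => (hd t).differentiableAt) (fun t => (hd t).deriv) s t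

theorem isReducedMotion (hy : IsMotion (fun _ => 1) y) (hp : ∀ t, IsParallelogram (y t))
    (t₀ : ℝ) : IsReducedMotion (normSq (y t₀ 0) + normSq (y t₀ 1))
      (fun t => (hopf (y t 0) (y t 1)).1) fun t => (hopf (y t 0) (y t 1)).2 where
  sphere t := by rw [hy.normSq_add_normSq_eq hp t₀ t, normSq_hopf_fst_add_sq]
  re_sq_lt t := by
    have := normSq_pos.2 ((hp t).ne_zero 0)
    have := normSq_pos.2 ((hp t).ne_zero 1)
    rw [← sub_pos, hy.normSq_add_normSq_eq hp t₀ t, sq_sub_hopf_re_sq]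
    positivity
  im_sq_lt t := by
    rw [← sub_pos, hy.normSq_add_normSq_eq hp t₀ t, sq_sub_hopf_im_sq]
    exact normSq_pos.2 (hp t).sq_sub_sq_ne_zero
  hasDerivAt t := by
    have hd := hy.hasDerivAt (fun _ => one_ne_zero) t
    refine (hasDerivAt_complex_mk ((hy.hasDerivAt_normSq t 0).fun_sub (hy.hasDerivAt_normSq t 1))
      ((hasDerivAt_re_mul_conj (hd 0) (hd 1)).const_mul 2)).congr_deriv ?_
    rw [reducedVelocity, hy.normSq_add_normSq_eq hp t₀ t, sq_sub_hopf_re_sq, sq_sub_hopf_im_sq,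
      (hp t).re_velocity_zero_mul_conj, (hp t).re_velocity_one_mul_conj,
      (hp t).re_velocity_mul_conj_add]
    congr 1 <;> ring
  continuous_snd := by
    have h0 := (hy.differentiable 0).continuous
    have h1 := (hy.differentiable 1).continuous
    exact (continuous_im.comp (h0.mul h1.star)).const_mul 2

theorem isParallelogram (hy : IsMotion (fun _ => 1) y) {t₀ : ℝ} (hp : IsParallelogram (y t₀))
    (t : ℝ) : IsParallelogram (y t) := by
  refine ⟨hy.noCollision t, fun k => ?_⟩
  -- The rotation by `π` together with the renumbering `k ↦ k + 2` fixes the motion at `t₀`.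
  have hneg := hy.eq_rotate_comp_perm (fun _ => one_ne_zero) (w := -1) (by simp)
    (e := Equiv.addRight 2) (fun _ => rfl) (h := 0) (t₀ := t₀)
    (fun k => by simp [hp.neg]) t k
  simpa [neg_eq_iff_eq_neg] using hneg.symm

theorem exists_exchange_diagonals (hy : IsMotion (fun _ => 1) y)
    (hp : ∀ t, IsParallelogram (y t)) {t₀ : ℝ}
    (hlevel : 4 * (normSq (y t₀ 0) + normSq (y t₀ 1)) ^ 6 < 27 *
      reducedLevel (normSq (y t₀ 0) + normSq (y t₀ 1)) (hopf (y t₀ 0) (y t₀ 1)).1) :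
    ∃ h > 0, ∃ w : ℂ, ‖w‖ = 1 ∧ ∀ k, y (t₀ + h) k = w * y t₀ (k + 1) := by
  obtain ⟨h, hh, hW, hV⟩ := (hy.isReducedMotion hp t₀).exists_half_turn hlevel
  obtain ⟨w, hw, h0, h1⟩ := exists_norm_eq_one_of_hopf_eq ((hp t₀).ne_zero 1)
    ((Prod.ext hW hV : _ = (_, _)).trans (hopf_neg_right (y t₀ 0) (y t₀ 1)).symm)
    (by rw [normSq_neg, hy.normSq_add_normSq_eq hp _ t₀, add_comm])
  refine ⟨h, hh, w, hw, fun k => ?_⟩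
  fin_cases k
  · exact h0
  · simpa [(hp t₀).two] using h1
  · simp [(hp _).two, (hp _).three, h0]
  · simp [(hp _).three, h1]

theorem isSimpleRelativeChoreography_of_isParallelogram (hy : IsMotion (fun _ => 1) y) {t₀ : ℝ}
    (hp : IsParallelogram (y t₀))
    (hHI : 2 * Real.pi / 3 * hamiltonian (fun _ => 1) (y t₀)
      + Real.log (integralI (fun _ => 1) (y t₀)) < Real.log 108 / 6) :
    IsSimpleRelativeChoreography y := by
  obtain ⟨h, hh, w, hw, hshift⟩ :=
    hy.exists_exchange_diagonals (hy.isParallelogram hp) (hp.lt_reducedLevel_of_hamiltonian_lt hHI)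
  exact isSimpleRelativeChoreography_of_cyclic_shift (hy.differentiable 0).continuous hh hw
    (hy.eq_rotate_comp_perm (fun _ => one_ne_zero) hw (e := Equiv.addRight 1) (fun _ => rfl)
      hshift)

end IsMotion

end PointVortex

theorem theorem2 (z : ℝ → Fin 4 → ℂ)
    (hz : PointVortex.IsMotion (fun _ => 1) z) (t₀ : ℝ)
    (hQ : PointVortex.integralQ (fun _ => 1) (z t₀) = 0)
    (hP : PointVortex.integralP (fun _ => 1) (z t₀) = 0)
    (hsymm : PointVortex.IsCentrosymmetric (z t₀))
    (hHI : 2 * Real.pi / 3 * PointVortex.hamiltonian (fun _ => 1) (z t₀)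
        + Real.log (PointVortex.integralI (fun _ => 1) (z t₀)) < Real.log 108 / 6) :
    PointVortex.IsSimpleRelativeChoreography z := by
  have hsum : ∑ i, z t₀ i = 0 := by
    apply Complex.ext
    · simpa [PointVortex.integralQ] using hQ
    · simpa [PointVortex.integralP] using hP
  obtain ⟨e, hp⟩ := hsymm.exists_isParallelogram (hz.noCollision t₀) hsum
  have hy : PointVortex.IsMotion (fun _ => 1) fun t k => z t (e k) := by
    simpa only [one_mul] using hz.rotate_comp_perm (fun _ => one_ne_zero) norm_one e
  rw [← PointVortex.hamiltonian_comp_perm _ _ e, ← PointVortex.integralI_comp_perm _ _ e] at hHI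
  simpa using (hy.isSimpleRelativeChoreography_of_isParallelogram hp hHI).comp e.symm
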